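/- Let $P$ be a simple polygon in the plane with edge set $E$, and let $\delta\colon E\to\mathbb{R}_{\ge 0}$. In the additively-weighted wavefront propagation of $(P,\delta)$ the wavefront at time $0$ is $P$. At time $t\ge 0$ the wavefront fragments emanated by an edge $e$ lie on the line $\overline{e}+\max(0,t-\delta(e))\,n_e$, where $\overline{e}$ is the supporting line of $e$ and $n_e$ is its inward unit normal; thus $e$ is stationary until time $\delta(e)$ and then moves inwards at unit speed. Fragments that are adjacent on the wavefront stay adjacent, and the wavefront is kept planar by events: in an edge event a fragment that has shrunk to length zero is removed, and its two neighbours become adjacent; in a split event a vertex of a wavefront polygon reaches another fragment of it, and the polygon is split there into two. Wavefront polygons that have collapsed are removed, and the process ends when none is left. (If two consecutive collinear fragments, exactly one of which is moving, become adjacent or start to have different speeds, then one of them, either one, takes over the other at once.) Let $e(t)$ be the set of wavefront fragments of $e$ at time $t$ (at the time of an event, those just before and those just after it), and let $f(e)=\bigcup_{t\ge 0}e(t)$ be the face of $e$ in the additively-weighted straight skeleton, where $e(t)$ is identified with the union of its fragments. Then the following hold. 1. For every $P$, every $\delta$, every additively-weighted wavefront propagation of $(P,\delta)$ and every edge $e$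 of $P$, the face $f(e)$ is connected. 2. There are $P$, $\delta$, a propagation and an edge $e$ such that the interior of $f(e)$ is empty. 3. There are $P$, $\delta$, a propagation and an edge $e$ such that the interior of $f(e)$ is nonempty and disconnected. 4. There are $P$, $\delta$, a propagation and an edge $e$ such that the interior of $f(e)$ is nonempty and not adjacent to $e$: its closure is disjoint from $e$. -/

import Mathlib

open scoped NNReal

noncomputable section

namespace StraightSkeleton

/-- The Euclidean plane. -/
abbrev Plane : Type := EuclideanSpace ℝ (Fin 2)

/-- The determinant of two plane vectors. -/
def cross (u v : Plane) : ℝ := u 0 * v 1 - u 1 * v 0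

/-- A simple polygon with `n` vertices, listed counterclockwise, so that the interior lies to the
left of every edge. Edge `i` runs from vertex `i` to the cyclically next vertex. Interior angles of
180 degrees are permitted. -/
structure SimplePolygon (n : ℕ) extends Polygon Plane n where
  three_le : 3 ≤ n
  nondegenerate : toPolygon.HasNondegenerateEdges
  /-- Two different edges meet at most in a vertex that they share as neighbours. -/
  edges_inter : ∀ i j : Fin n, i ≠ j →
    ∀ x ∈ toPolygon.edgeSet ℝ i, x ∈ toPolygon.edgeSet ℝ j →
      (j = finRotate n i ∧ x = vertices j) ∨ (i = finRotate n j ∧ x = vertices i)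
  /-- The signed area is positive. -/
  counterclockwise : 0 < ∑ i : Fin n, cross (vertices i) (vertices (finRotate n i))

namespace SimplePolygon

variable {n : ℕ}

/-- The unit vector in the direction of edge `e`. -/
def direction (P : SimplePolygon n) (e : Fin n) : Plane :=
  ‖P.vertices (finRotate n e) - P.vertices e‖⁻¹ • (P.vertices (finRotate n e) - P.vertices e)

/-- The inward facing unit normal of edge `e`: its direction turned left by 90 degrees. -/
def inwardNormal (P : SimplePolygon n) (e : Fin n) : Plane :=
  !₂[-(P.direction e 1), P.direction e 0]

/-- The line that carries the wavefront fragments of `e` at time `t`: the supporting line of `e`,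
displaced by `max 0 (t - δ e)` times the inward unit normal. -/
def supportingLine (P : SimplePolygon n) (δ : Fin n → ℝ≥0) (e : Fin n) (t : ℝ) : Set Plane :=
  {x | ∃ s : ℝ, x = P.vertices e + s • P.direction e + max 0 (t - δ e) • P.inwardNormal e}

end SimplePolygon

/-- A wavefront polygon at one instant, as the cyclic list of its fragments: each entry holds the
edge of the input polygon that emanated the fragment, and the start point of the fragment. The end
point of a fragment is the start point of the cyclically next entry. -/
abbrev WavefrontPolygon (n : ℕ) : Type := List (Fin n × Plane)

/-- A wavefront polygon whose vertices move: start points are functions of time. -/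
abbrev KineticPolygon (n : ℕ) : Type := List (Fin n × (ℝ → Plane))

/-- The wavefront polygon at time `t`. -/
def KineticPolygon.at {n : ℕ} (L : KineticPolygon n) (t : ℝ) : WavefrontPolygon n :=
  L.map fun a => (a.1, a.2 t)

/-- The vertices of a kinetic polygon, as triples
(edge of the incoming fragment, edge of the outgoing fragment, trajectory). -/
def KineticPolygon.corners {n : ℕ} (L : KineticPolygon n) : List (Fin n × Fin n × (ℝ → Plane)) :=
  List.zipWith (fun a b => (a.1, b.1, b.2)) L (L.rotate 1)

/-- The fragments of a wavefront polygon, as triples (edge, start point, end point). -/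
def fragments {n : ℕ} (L : WavefrontPolygon n) : List (Fin n × Plane × Plane) :=
  List.zipWith (fun a b => (a.1, a.2, b.2)) L (L.rotate 1)

/-- All fragments at time `t` of a wavefront that consists of several polygons. -/
def fragmentsAt {n : ℕ} (W : List (KineticPolygon n)) (t : ℝ) : List (Fin n × Plane × Plane) :=
  W.flatMap fun L => fragments (L.at t)

/-- Two fragments meet at most in a point that is the end of one and the start of the other. If this
holds for any two of a family of cyclic lists of nondegenerate fragments, then these lists are
simple polygons with at least three edges, and no two of these polygons touch. -/
def NonCrossing {n : ℕ} (f g : Fin n × Plane × Plane) : Prop :=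
  ∀ x ∈ segment ℝ f.2.1 f.2.2, x ∈ segment ℝ g.2.1 g.2.2 →
    (x = f.2.2 ∧ x = g.2.1) ∨ (x = f.2.1 ∧ x = g.2.2)

/-- The wavefront `W` keeps its combinatorial structure and moves as prescribed during `[s, t]`.
For `s = t` this only places the vertices on the supporting lines. -/
structure IsMotion {n : ℕ} (P : SimplePolygon n) (δ : Fin n → ℝ≥0) (s t : ℝ)
    (W : List (KineticPolygon n)) : Prop where
  /-- Vertices do not jump. -/
  continuous : ∀ L ∈ W, ∀ c ∈ L.corners, ContinuousOn c.2.2 (Set.Icc s t)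
  /-- Incidences are preserved: a vertex stays on the moving supporting lines of the two edges
  whose fragments it joins. -/
  incident : ∀ L ∈ W, ∀ c ∈ L.corners, ∀ τ ∈ Set.Icc s t,
    c.2.2 τ ∈ P.supportingLine δ c.1 τ ∧ c.2.2 τ ∈ P.supportingLine δ c.2.1 τ
  /-- A vertex between two parallel fragments moves along the bisector of its straight angle. -/
  bisector : ∀ L ∈ W, ∀ c ∈ L.corners, cross (P.direction c.1) (P.direction c.2.1) = 0 →
    ∀ τ ∈ Set.Icc s t, inner ℝ (P.direction c.1) (c.2.2 τ - c.2.2 s) = 0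
  /-- Before the next event, every fragment has positive length and the orientation of its edge. -/
  oriented : ∀ τ ∈ Set.Ico s t, ∀ f ∈ fragmentsAt W τ,
    ∃ l : ℝ, 0 < l ∧ f.2.2 - f.2.1 = l • P.direction f.1
  /-- Between events the wavefront is planar. -/
  planar : ∀ τ ∈ Set.Ioo s t, (fragmentsAt W τ).Pairwise NonCrossing

/-- The elementary changes at time `t` of a single wavefront polygon, which is replaced by a list of
polygons. Simultaneous and more complex events are sequences of these. -/
inductive PolygonEvent {n : ℕ} (P : SimplePolygon n) (δ : Fin n → ℝ≥0) (t : ℝ) :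
    WavefrontPolygon n → List (WavefrontPolygon n) → Prop
  /-- Edge event: a fragment of length zero is removed, its neighbours become adjacent. -/
  | edge (e f : Fin n) (p : Plane) (R : WavefrontPolygon n) :
      PolygonEvent P δ t ((e, p) :: (f, p) :: R) [(f, p) :: R]
  /-- Split event: the vertex `v` lies on another fragment, that of edge `c` from `p` to `q`. The
  polygon is split there into two polygons, each of which receives a part of this fragment. -/
  | split (b c g : Fin n) (v p q : Plane) (X R : WavefrontPolygon n) (hv : v ∈ segment ℝ p q) :
      PolygonEvent P δ t ((b, v) :: X ++ (c, p) :: (g, q) :: R)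
        [(b, v) :: X ++ [(c, p)], (c, v) :: (g, q) :: R]
  /-- A polygon with at most two fragments has collapsed and is removed. (With two fragments, these
  are parallel edges, or parts of them, that have moved into each other.) -/
  | collapse (L : WavefrontPolygon n) (hL : L.length ≤ 2) : PolygonEvent P δ t L []
  /-- Two consecutive collinear fragments of which exactly one is moving have no common vertex
  motion. Then one of them takes over the other at once: here the first one, ... -/
  | takeoverLeft (a b c : Fin n) (p q r : Plane) (R : WavefrontPolygon n)
      (hdir : P.direction a = P.direction b)
      (hspeed : ¬ ((δ a : ℝ) ≤ t ↔ (δ b : ℝ) ≤ t)) (hpq : p ≠ q) (hqr : q ≠ r) :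
      PolygonEvent P δ t ((a, p) :: (b, q) :: (c, r) :: R) [(a, p) :: (c, r) :: R]
  /-- ... and here the second one. Either choice is admitted. -/
  | takeoverRight (a b c : Fin n) (p q r : Plane) (R : WavefrontPolygon n)
      (hdir : P.direction a = P.direction b)
      (hspeed : ¬ ((δ a : ℝ) ≤ t ↔ (δ b : ℝ) ≤ t)) (hpq : p ≠ q) (hqr : q ≠ r) :
      PolygonEvent P δ t ((a, p) :: (b, q) :: (c, r) :: R) [(b, p) :: (c, r) :: R]

/-- The elementary events of a wavefront at time `t`. -/
inductive WavefrontEvent {n : ℕ} (P : SimplePolygon n) (δ : Fin n → ℝ≥0) (t : ℝ) :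
    List (WavefrontPolygon n) → List (WavefrontPolygon n) → Prop
  /-- One polygon `L` of the wavefront, read from a suitable starting fragment, changes. -/
  | polygon (A B : List (WavefrontPolygon n)) (L L' : WavefrontPolygon n)
      (M : List (WavefrontPolygon n)) (hrot : L.IsRotated L') (h : PolygonEvent P δ t L' M) :
      WavefrontEvent P δ t (A ++ L :: B) (A ++ M ++ B)
  /-- Speed-change event: the edge `e` starts to move. The combinatorial structure is unchanged. -/
  | speedChange (e : Fin n) (he : (δ e : ℝ) = t) (C : List (WavefrontPolygon n)) :
      WavefrontEvent P δ t C C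

/-- An additively-weighted wavefront propagation of `P` with additive weights `δ`, from the polygon
`P` at time zero until all wavefront polygons have collapsed. It passes through finitely many
stages; stage `k` lasts from `time k` to `time (k + 1)` and ends with an elementary event. Events
that happen at the same time are separated by stages of duration zero. -/
structure Propagation {n : ℕ} (P : SimplePolygon n) (δ : Fin n → ℝ≥0) where
  numStages : ℕ
  time : ℕ → ℝ
  wavefront : ℕ → List (KineticPolygon n)
  time_zero : time 0 = 0
  time_le : ∀ k < numStages, time k ≤ time (k + 1)
  initial : (wavefront 0).map (fun L => L.at (time 0)) = [List.ofFn fun i => (i, P.vertices i)]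
  motion : ∀ k < numStages, IsMotion P δ (time k) (time (k + 1)) (wavefront k)
  event : ∀ k < numStages, WavefrontEvent P δ (time (k + 1))
    ((wavefront k).map fun L => L.at (time (k + 1)))
    ((wavefront (k + 1)).map fun L => L.at (time (k + 1)))
  final : wavefront numStages = []

namespace Propagation

variable {n : ℕ} {P : SimplePolygon n} {δ : Fin n → ℝ≥0}

/-- `e(t)`, the set of the wavefront fragments of edge `e` at time `t`. At the time of an event it
holds the fragments just before and those just after the event. -/
def edgeFragments (W : Propagation P δ) (e : Fin n) (t : ℝ) : Set (Set Plane) :=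
  {S | ∃ k < W.numStages, t ∈ Set.Icc (W.time k) (W.time (k + 1)) ∧
    ∃ f ∈ fragmentsAt (W.wavefront k) t, f.1 = e ∧ S = segment ℝ f.2.1 f.2.2}

/-- The face `f(e)`: the union of `e(t)` over all `t ≥ 0`. -/
def face (W : Propagation P δ) (e : Fin n) : Set Plane :=
  ⋃ t : ℝ, ⋃ _ : 0 ≤ t, ⋃₀ W.edgeFragments e t

end Propagation

end StraightSkeleton

end

noncomputable section

/-! Connectedness is an induction over the stages. Within one stage a fragment is a segment with
continuously moving end points, so it sweeps a connected set (`isPreconnected_sweptSet`). Across an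
event, every fragment of the new wavefront has a common point with a fragment of the same edge in
the old one (`WavefrontEvent.meetsEqualEdge`). Hence any point of a face is joined, inside the face,
to the fragment of the edge at time 0, which is the edge itself; its first vertex serves as base
point.

The three existence claims come from two explicit propagations, and both use that a stationary
fragment adds only a piece of a line to its face. In `Dart` the edge on `x = 24` waits until
everything has collapsed, so its face is one-dimensional. The bottom edge of the same polygon waits
while its two moving neighbours drag its fragment along the line `y = 0`, from `[0, 4]` to `[20,
24]`; only then does it sweep area, far from where it began. In `Pentagon` a reflex vertex splits
the waiting bottom fragment at the origin just when it starts to move, and the two halves sweep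
triangles that touch only in that point. -/

namespace StraightSkeleton

variable {n : ℕ}

/-! ### Fragments across events -/

/-- The fragments of an open chain of a wavefront polygon, which ends at the point `z`. -/
def chainFragments : WavefrontPolygon n → Plane → List (Fin n × Plane × Plane)
  | [], _ => []
  | [a], z => [(a.1, a.2, z)]
  | a :: b :: R, z => (a.1, a.2, b.2) :: chainFragments (b :: R) z

theorem chainFragments_eq_zipWith (a : Fin n × Plane) (R : WavefrontPolygon n)
    (z : Fin n × Plane) :
    chainFragments (a :: R) z.2 =
      List.zipWith (fun a b => (a.1, a.2, b.2)) (a :: R) (R ++ [z]) := by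
  induction R generalizing a with
  | nil => rfl
  | cons b R ih => simp [chainFragments, ih]

/-- Cuts the cyclic list open at its first vertex, which becomes the explicit end point. Open chains
are compatible with concatenation, which is what the split event requires. -/
theorem fragments_cons (e : Fin n) (p : Plane) (R : WavefrontPolygon n) :
    fragments ((e, p) :: R) = chainFragments ((e, p) :: R) p := by
  rw [chainFragments_eq_zipWith (e, p) R (e, p)]
  simp [fragments]

theorem chainFragments_append (A : WavefrontPolygon n) (b : Fin n × Plane)
    (B : WavefrontPolygon n) (z : Plane) :
    chainFragments (A ++ b :: B) z = chainFragments A b.2 ++ chainFragments (b :: B) z := by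
  induction A with
  | nil => rfl
  | cons a A ih =>
    cases A with
    | nil => rfl
    | cons c A => simpa [chainFragments] using ih

theorem fragments_rotate (L : WavefrontPolygon n) (k : ℕ) :
    fragments (L.rotate k) = (fragments L).rotate k := by
  unfold fragments
  rw [List.zipWith_rotate_distrib _ _ _ _ (by simp), List.rotate_rotate, List.rotate_rotate,
    Nat.add_comm]

theorem mem_fragments_of_isRotated {L L' : WavefrontPolygon n} (h : L.IsRotated L')
    {f : Fin n × Plane × Plane} (hf : f ∈ fragments L') : f ∈ fragments L := by
  obtain ⟨k, rfl⟩ := h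
  rwa [fragments_rotate, List.mem_rotate] at hf

/-- Some fragment of the list `F` has the same edge as `f` and a common point with `f`. -/
def MeetsEqualEdge (F : List (Fin n × Plane × Plane)) (f : Fin n × Plane × Plane) : Prop :=
  ∃ g ∈ F, g.1 = f.1 ∧ ∃ x ∈ segment ℝ f.2.1 f.2.2, x ∈ segment ℝ g.2.1 g.2.2

theorem meetsEqualEdge_of_mem {F : List (Fin n × Plane × Plane)} {f : Fin n × Plane × Plane}
    (h : f ∈ F) : MeetsEqualEdge F f :=
  ⟨f, h, rfl, f.2.1, left_mem_segment _ _ _, left_mem_segment _ _ _⟩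

/-- Events only delete, cut or extend fragments; none creates one away from the earlier fragments of
its edge. This is the step of the connectedness proof across an event. -/
theorem PolygonEvent.meetsEqualEdge {P : SimplePolygon n} {δ : Fin n → ℝ≥0} {t : ℝ}
    {L : WavefrontPolygon n} {M : List (WavefrontPolygon n)} (h : PolygonEvent P δ t L M)
    {f : Fin n × Plane × Plane} (hf : f ∈ M.flatMap fragments) :
    MeetsEqualEdge (fragments L) f := by
  cases h with
  | edge e g p R =>
    apply meetsEqualEdge_of_mem
    simp only [List.flatMap_cons, List.flatMap_nil, List.append_nil, fragments_cons] at hf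
    simp [fragments_cons, chainFragments, hf]
  | split b c g v p q X R hv =>
    have hL : fragments ((b, v) :: X ++ (c, p) :: (g, q) :: R) =
        chainFragments ((b, v) :: X) p ++ (c, p, q) :: chainFragments ((g, q) :: R) v := by
      rw [List.cons_append, fragments_cons, ← List.cons_append, chainFragments_append]
      rfl
    have h1 : fragments ((b, v) :: X ++ [(c, p)]) =
        chainFragments ((b, v) :: X) p ++ [(c, p, v)] := by
      rw [List.cons_append, fragments_cons, ← List.cons_append, chainFragments_append]
      rfl
    have h2 : fragments ((c, v) :: (g, q) :: R) =
        (c, v, q) :: chainFragments ((g, q) :: R) v := by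
      rw [fragments_cons]
      rfl
    simp only [List.flatMap_cons, List.flatMap_nil, List.append_nil, h1, h2, List.mem_append,
      List.mem_cons, List.not_mem_nil, or_false] at hf
    rw [hL]
    -- The two halves of the split fragment are the only new ones; each has the split point `v` in
    -- common with the whole.
    rcases hf with (hf | rfl) | rfl | hf
    · exact meetsEqualEdge_of_mem (by simp [hf])
    · exact ⟨(c, p, q), by simp, rfl, v, right_mem_segment _ _ _, hv⟩
    · exact ⟨(c, p, q), by simp, rfl, v, left_mem_segment _ _ _, hv⟩
    · exact meetsEqualEdge_of_mem (by simp [hf])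
  | collapse L hL => simp at hf
  | takeoverLeft a b c p q r R =>
    simp only [List.flatMap_cons, List.flatMap_nil, List.append_nil, fragments_cons,
      chainFragments, List.mem_cons] at hf
    rcases hf with rfl | hf
    · exact ⟨(a, p, q), by simp [fragments_cons, chainFragments], rfl, p,
        left_mem_segment _ _ _, left_mem_segment _ _ _⟩
    · exact meetsEqualEdge_of_mem (by simp [fragments_cons, chainFragments, hf])
  | takeoverRight a b c p q r R =>
    simp only [List.flatMap_cons, List.flatMap_nil, List.append_nil, fragments_cons,
      chainFragments, List.mem_cons] at hf
    rcases hf with rfl | hf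
    · exact ⟨(b, q, r), by simp [fragments_cons, chainFragments], rfl, r,
        right_mem_segment _ _ _, right_mem_segment _ _ _⟩
    · exact meetsEqualEdge_of_mem (by simp [fragments_cons, chainFragments, hf])

theorem WavefrontEvent.meetsEqualEdge {P : SimplePolygon n} {δ : Fin n → ℝ≥0} {t : ℝ}
    {C D : List (WavefrontPolygon n)} (h : WavefrontEvent P δ t C D)
    {f : Fin n × Plane × Plane} (hf : f ∈ D.flatMap fragments) :
    MeetsEqualEdge (C.flatMap fragments) f := by
  cases h with
  | polygon A B L L' M hrot h =>
    simp only [List.flatMap_append, List.mem_append] at hf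
    rcases hf with (hf | hf) | hf
    · exact meetsEqualEdge_of_mem (by simp [hf])
    · obtain ⟨g, hg, hgf, hx⟩ := h.meetsEqualEdge hf
      refine ⟨g, ?_, hgf, hx⟩
      simp [mem_fragments_of_isRotated hrot hg]
    · exact meetsEqualEdge_of_mem (by simp [hf])
  | speedChange e he C => exact meetsEqualEdge_of_mem hf

/-- The polygon `L` and the index `i` make sense at every time, so a fragment found at one instant
can be followed through its whole stage. -/
theorem mem_fragmentsAt {W : List (KineticPolygon n)} {t : ℝ} {f : Fin n × Plane × Plane} :
    f ∈ fragmentsAt W t ↔ ∃ L ∈ W, ∃ i, ∃ hi : i < L.length,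
      f = (L[i].1, L[i].2 t, (L[(i + 1) % L.length]'(Nat.mod_lt _ (by omega))).2 t) := by
  simp only [fragmentsAt, List.mem_flatMap, fragments, KineticPolygon.at]
  refine exists_congr fun L => and_congr_right fun _ => ?_
  simp only [List.mem_iff_getElem, List.length_zipWith, List.length_map, List.length_rotate, min_self,
    List.getElem_zipWith, List.getElem_map, List.getElem_rotate]
  exact ⟨fun ⟨i, hi, h⟩ => ⟨i, hi, h.symm⟩, fun ⟨i, hi, h⟩ => ⟨i, hi, h.symm⟩⟩

theorem IsMotion.continuousOn {P : SimplePolygon n} {δ : Fin n → ℝ≥0} {s t : ℝ}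
    {W : List (KineticPolygon n)} (h : IsMotion P δ s t W) {L : KineticPolygon n} (hL : L ∈ W)
    {a : Fin n × (ℝ → Plane)} (ha : a ∈ L) : ContinuousOn a.2 (Set.Icc s t) := by
  -- A corner carries the start point of its outgoing fragment, so corner `i` has the trajectory of
  -- entry `i` of the rotated list.
  obtain ⟨i, hi, rfl⟩ := List.getElem_of_mem (List.mem_rotate.2 ha : a ∈ L.rotate 1)
  have hi' : i < L.length := by simpa using hi
  refine h.continuous L hL (L[i].1, (L.rotate 1)[i].1, (L.rotate 1)[i].2) ?_
  refine List.mem_iff_getElem.2 ⟨i, by simpa [KineticPolygon.corners] using hi', ?_⟩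
  simp [KineticPolygon.corners]

theorem fragmentsAt_eq_flatMap (W : List (KineticPolygon n)) (t : ℝ) :
    fragmentsAt W t = (W.map fun L => L.at t).flatMap fragments := by
  simp only [fragmentsAt, List.flatMap_map]

/-! ### Connectedness of faces -/

/-- The set swept during `[s, t]` by the segment with moving end points `u` and `v`. -/
def sweptSet (s t : ℝ) (u v : ℝ → Plane) : Set Plane :=
  {x | ∃ τ ∈ Set.Icc s t, x ∈ segment ℝ (u τ) (v τ)}

/-- A segment whose end points move continuously sweeps a connected set. -/
theorem isPreconnected_sweptSet {s t : ℝ} {u v : ℝ → Plane}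
    (hu : ContinuousOn u (Set.Icc s t)) (hv : ContinuousOn v (Set.Icc s t)) :
    IsPreconnected (sweptSet s t u v) := by
  -- The swept set is the continuous image of this rectangle, with coordinates time and position
  -- along the segment.
  have hc : IsPreconnected (Set.Icc s t ×ˢ Set.Icc (0 : ℝ) 1) :=
    isPreconnected_Icc.prod isPreconnected_Icc
  have hcont : ContinuousOn (fun z : ℝ × ℝ => (1 - z.2) • u z.1 + z.2 • v z.1)
      (Set.Icc s t ×ˢ Set.Icc (0 : ℝ) 1) := by
    have h1 : ContinuousOn (fun z : ℝ × ℝ => u z.1) (Set.Icc s t ×ˢ Set.Icc (0 : ℝ) 1) :=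
      hu.comp continuousOn_fst fun z hz => hz.1
    have h2 : ContinuousOn (fun z : ℝ × ℝ => v z.1) (Set.Icc s t ×ˢ Set.Icc (0 : ℝ) 1) :=
      hv.comp continuousOn_fst fun z hz => hz.1
    exact ((continuousOn_const.sub continuousOn_snd).smul h1).add (continuousOn_snd.smul h2)
  convert hc.image _ hcont using 1
  ext x
  simp only [sweptSet, segment_eq_image, Set.mem_ofPred_eq, Set.mem_image, Set.mem_prod, Prod.exists]
  constructor
  · rintro ⟨τ, hτ, θ, hθ, rfl⟩
    exact ⟨τ, θ, ⟨hτ, hθ⟩, rfl⟩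
  · rintro ⟨τ, θ, ⟨hτ, hθ⟩, rfl⟩
    exact ⟨τ, hτ, θ, hθ, rfl⟩

namespace Propagation

variable {P : SimplePolygon n} {δ : Fin n → ℝ≥0}

theorem time_nonneg (W : Propagation P δ) {k : ℕ} (hk : k ≤ W.numStages) : 0 ≤ W.time k := by
  induction k with
  | zero => exact W.time_zero.ge
  | succ k ih => exact (ih (by omega)).trans (W.time_le k (by omega))

theorem mem_face (W : Propagation P δ) {e : Fin n} {x : Plane} :
    x ∈ W.face e ↔ ∃ k < W.numStages, ∃ τ ∈ Set.Icc (W.time k) (W.time (k + 1)),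
      ∃ f ∈ fragmentsAt (W.wavefront k) τ, f.1 = e ∧ x ∈ segment ℝ f.2.1 f.2.2 := by
  simp only [face, edgeFragments, Set.mem_iUnion, Set.mem_sUnion, Set.mem_ofPred_eq]
  constructor
  · rintro ⟨τ, -, S, ⟨k, hk, hτ, f, hf, he, rfl⟩, hx⟩
    exact ⟨k, hk, τ, hτ, f, hf, he, hx⟩
  · rintro ⟨k, hk, τ, hτ, f, hf, he, hx⟩
    exact ⟨τ, (W.time_nonneg hk.le).trans hτ.1, _, ⟨k, hk, hτ, f, hf, he, rfl⟩, hx⟩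

/-- Without stages the initial wavefront would also be the final, empty one. -/
theorem numStages_pos (W : Propagation P δ) : 0 < W.numStages := by
  by_contra h
  have h0 : W.numStages = 0 := by omega
  have := W.initial
  rw [← h0, W.final] at this
  simp at this

theorem mem_fragmentsAt_initial (W : Propagation P δ) {f : Fin n × Plane × Plane} :
    f ∈ fragmentsAt (W.wavefront 0) (W.time 0) ↔
      ∃ i, f = (i, P.vertices i, P.vertices (finRotate n i)) := by
  have h : fragmentsAt (W.wavefront 0) (W.time 0) =
      fragments (List.ofFn fun i => (i, P.vertices i)) := by
    have := congrArg (List.flatMap fragments) W.initial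
    simpa [fragmentsAt, List.flatMap_map] using this
  rw [h]
  have hrot : ∀ i : Fin n, (finRotate n i : ℕ) = (i + 1) % n := by
    intro i
    obtain ⟨m, rfl⟩ : ∃ m, n = m + 1 := ⟨n - 1, by have := i.2; omega⟩
    rw [finRotate_apply, Fin.val_add, Fin.val_one']
    simp
  simp only [fragments, List.mem_iff_getElem, List.length_zipWith, List.length_rotate,
    List.length_ofFn, min_self, List.getElem_zipWith, List.getElem_ofFn, List.getElem_rotate]
  constructor
  · rintro ⟨i, hi, rfl⟩
    refine ⟨⟨i, hi⟩, ?_⟩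
    have : finRotate n ⟨i, hi⟩ = ⟨(i + 1) % n, Nat.mod_lt _ (by omega)⟩ := Fin.ext (hrot _)
    rw [this]
  · rintro ⟨i, rfl⟩
    refine ⟨i, i.2, ?_⟩
    have : finRotate n i = ⟨(i + 1) % n, Nat.mod_lt _ (by have := i.2; omega)⟩ :=
      Fin.ext (hrot _)
    rw [this]

/-- Within the face, every point is connected to the first vertex of the edge. -/
theorem exists_isPreconnected_subset_face (W : Propagation P δ) (e : Fin n) (k : ℕ)
    (hk : k < W.numStages) {τ : ℝ} (hτ : τ ∈ Set.Icc (W.time k) (W.time (k + 1)))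
    {f : Fin n × Plane × Plane} (hf : f ∈ fragmentsAt (W.wavefront k) τ) (hfe : f.1 = e)
    {x : Plane} (hx : x ∈ segment ℝ f.2.1 f.2.2) :
    ∃ S ⊆ W.face e, P.vertices e ∈ S ∧ x ∈ S ∧ IsPreconnected S := by
  induction k generalizing τ f x with
  | zero =>
    obtain ⟨L, hL, i, hi, rfl⟩ := mem_fragmentsAt.1 hf
    refine ⟨sweptSet (W.time 0) (W.time (0 + 1)) L[i].2 (L[(i + 1) % L.length]'(Nat.mod_lt _
      (by omega))).2, ?_, ?_, ⟨τ, hτ, hx⟩, isPreconnected_sweptSet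
      ((W.motion 0 hk).continuousOn hL (List.getElem_mem hi))
      ((W.motion 0 hk).continuousOn hL (List.getElem_mem _))⟩
    · rintro y ⟨τ', hτ', hy⟩
      exact W.mem_face.2 ⟨0, hk, τ', hτ', _, mem_fragmentsAt.2 ⟨L, hL, i, hi, rfl⟩, hfe, hy⟩
    · have h0 := (mem_fragmentsAt (t := W.time 0)).2 ⟨L, hL, i, hi, rfl⟩
      -- Followed back to time 0, the fragment is the edge `e` itself and so starts at the base
      -- point.
      obtain ⟨j, hj⟩ := W.mem_fragmentsAt_initial.1 h0
      obtain rfl : e = j := hfe.symm.trans (congrArg Prod.fst hj)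
      refine ⟨W.time 0, ⟨le_rfl, W.time_le 0 hk⟩, ?_⟩
      have h1 : L[i].2 (W.time 0) = P.vertices e := congrArg (fun z => z.2.1) hj
      rw [h1]
      exact left_mem_segment _ _ _
  | succ k ih =>
    obtain ⟨L, hL, i, hi, rfl⟩ := mem_fragmentsAt.1 hf
    have hstart := (mem_fragmentsAt (t := W.time (k + 1))).2 ⟨L, hL, i, hi, rfl⟩
    -- At the start of the stage the fragment meets, in `y`, a fragment `g` from the end of the
    -- previous stage. The induction hypothesis joins `y` to the base point, and the set swept in
    -- this stage is glued on at `y`.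
    obtain ⟨g, hg, hge, y, hy, hyg⟩ := (W.event k (by omega)).meetsEqualEdge
      (fragmentsAt_eq_flatMap (W.wavefront (k + 1)) _ ▸ hstart)
    obtain ⟨S, hS, heS, hyS, hSc⟩ := ih (by omega) ⟨W.time_le k (by omega), le_rfl⟩
      ((fragmentsAt_eq_flatMap (W.wavefront k) _).symm ▸ hg) (hge.trans hfe) hyg
    refine ⟨S ∪ sweptSet (W.time (k + 1)) (W.time (k + 1 + 1)) L[i].2
      (L[(i + 1) % L.length]'(Nat.mod_lt _ (by omega))).2, ?_, Or.inl heS, Or.inr ⟨τ, hτ, hx⟩,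
      hSc.union y hyS ⟨W.time (k + 1), ⟨le_rfl, W.time_le (k + 1) hk⟩, hy⟩
        (isPreconnected_sweptSet
          ((W.motion (k + 1) hk).continuousOn hL (List.getElem_mem hi))
          ((W.motion (k + 1) hk).continuousOn hL (List.getElem_mem _)))⟩
    refine Set.union_subset hS ?_
    rintro y ⟨τ', hτ', hy⟩
    exact W.mem_face.2 ⟨k + 1, hk, τ', hτ', _, mem_fragmentsAt.2 ⟨L, hL, i, hi, rfl⟩, hfe, hy⟩

theorem vertex_mem_face (W : Propagation P δ) (e : Fin n) : P.vertices e ∈ W.face e :=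
  W.mem_face.2 ⟨0, W.numStages_pos, W.time 0, ⟨le_rfl, W.time_le 0 W.numStages_pos⟩, _,
    W.mem_fragmentsAt_initial.2 ⟨e, rfl⟩, rfl, left_mem_segment _ _ _⟩

theorem isConnected_face (W : Propagation P δ) (e : Fin n) : IsConnected (W.face e) := by
  refine ⟨⟨_, W.vertex_mem_face e⟩, isPreconnected_of_forall (P.vertices e) fun x hx => ?_⟩
  obtain ⟨k, hk, τ, hτ, f, hf, he, hxf⟩ := W.mem_face.1 hx
  exact W.exists_isPreconnected_subset_face e k hk hτ hf he hxf

end Propagation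

/-! ### Coordinate criteria for explicit wavefronts -/

theorem exists_coord_of_mem_segment {p q x : Plane} (h : x ∈ segment ℝ p q) :
    ∃ θ ∈ Set.Icc (0 : ℝ) 1, ∀ i, x i = p i + θ * (q i - p i) := by
  rw [segment_eq_image'] at h
  obtain ⟨θ, hθ, rfl⟩ := h
  exact ⟨θ, hθ, fun i => by simp⟩

theorem mem_segment_of_coord {p q x : Plane} {θ : ℝ} (hθ : θ ∈ Set.Icc (0 : ℝ) 1)
    (h0 : x 0 = p 0 + θ * (q 0 - p 0)) (h1 : x 1 = p 1 + θ * (q 1 - p 1)) :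
    x ∈ segment ℝ p q := by
  rw [segment_eq_image']
  refine ⟨θ, hθ, ?_⟩
  ext i
  fin_cases i
  · simpa using h0.symm
  · simpa using h1.symm

/-- A half-plane that contains the end points of a segment contains the segment. -/
theorem le_of_mem_segment {p q x : Plane} (a b c : ℝ) (hp : a * p 0 + b * p 1 ≤ c)
    (hq : a * q 0 + b * q 1 ≤ c) (h : x ∈ segment ℝ p q) : a * x 0 + b * x 1 ≤ c := by
  obtain ⟨θ, ⟨h0, h1⟩, hx⟩ := exists_coord_of_mem_segment h
  rw [hx 0, hx 1]
  nlinarith [mul_le_mul_of_nonneg_left hp (sub_nonneg.2 h1), mul_le_mul_of_nonneg_left hq h0]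

theorem NonCrossing.symm {f g : Fin n × Plane × Plane} (h : NonCrossing f g) :
    NonCrossing g f := fun x hg hf => (h x hf hg).symm.imp And.symm And.symm

/-- Consecutive segments on non-parallel lines can meet only where the lines do, in the shared end
point. -/
theorem nonCrossing_of_cross_ne_zero {e g : Fin n} {p q r : Plane}
    (h : cross (q - p) (r - q) ≠ 0) : NonCrossing (e, p, q) (g, q, r) := by
  intro x hf hg
  obtain ⟨θ, -, hx⟩ := exists_coord_of_mem_segment hf
  obtain ⟨η, -, hy⟩ := exists_coord_of_mem_segment hg
  simp only [cross, PiLp.sub_apply] at *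
  have h0 := (hx 0).symm.trans (hy 0)
  have h1 := (hx 1).symm.trans (hy 1)
  -- Eliminating `η` from the two coordinate equations leaves `θ - 1` times the determinant.
  have : θ - 1 = 0 := by
    refine (mul_eq_zero.1 ?_).resolve_right h
    linear_combination (r 1 - q 1) * h0 - (r 0 - q 0) * h1
  left
  suffices x = q from ⟨this, this⟩
  ext i
  rw [hx i]
  linear_combination (q i - p i) * this

/-- Certifies non-adjacent fragments as disjoint. Only `g` has to avoid the separating line, so the
line may be chosen to pass through an end point of `f` or to contain `f`. -/
theorem nonCrossing_of_separated {f g : Fin n × Plane × Plane} (a b c : ℝ)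
    (h1 : a * f.2.1 0 + b * f.2.1 1 ≤ c) (h2 : a * f.2.2 0 + b * f.2.2 1 ≤ c)
    (h3 : c < a * g.2.1 0 + b * g.2.1 1) (h4 : c < a * g.2.2 0 + b * g.2.2 1) :
    NonCrossing f g := by
  intro x hf hg
  have hle := le_of_mem_segment a b c h1 h2 hf
  obtain ⟨θ, ⟨hθ0, hθ1⟩, hx⟩ := exists_coord_of_mem_segment hg
  exfalso
  rw [hx 0, hx 1] at hle
  rcases hθ0.eq_or_lt with rfl | hθ0
  · linarith
  · nlinarith [mul_lt_mul_of_pos_left h4 hθ0,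
      mul_le_mul_of_nonneg_left h3.le (sub_nonneg.2 hθ1)]

/-- `NonCrossing` speaks of coinciding points; injectivity of the vertices turns this into adjacency
of the indices. -/
theorem edges_inter_of_nonCrossing (p : Polygon Plane n) (hp : Function.Injective p.vertices)
    (h : ∀ i j : Fin n, i < j → NonCrossing (i, p.vertices i, p.vertices (finRotate n i))
      (j, p.vertices j, p.vertices (finRotate n j))) (i j : Fin n) (hij : i ≠ j) (x : Plane)
    (hi : x ∈ p.edgeSet ℝ i) (hj : x ∈ p.edgeSet ℝ j) :
    (j = finRotate n i ∧ x = p.vertices j) ∨ (i = finRotate n j ∧ x = p.vertices i) := by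
  rw [Polygon.edgeSet, affineSegment_eq_segment] at hi hj
  have : NonCrossing (i, p.vertices i, p.vertices (finRotate n i))
      (j, p.vertices j, p.vertices (finRotate n j)) := by
    rcases lt_or_gt_of_ne hij with hlt | hlt
    · exact h i j hlt
    · exact (h j i hlt).symm
  rcases this x hi hj with ⟨h1, h2⟩ | ⟨h1, h2⟩
  · exact Or.inl ⟨hp (h2.symm.trans h1), h2⟩
  · exact Or.inr ⟨hp (h1.symm.trans h2), h1⟩

theorem exists_pos_smul_of_coord {p q : Plane} (l a b : ℝ) (hl : 0 < l)
    (h₀ : q 0 - p 0 = l * a) (h₁ : q 1 - p 1 = l * b) :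
    ∃ l : ℝ, 0 < l ∧ q - p = l • (!₂[a, b] : Plane) := by
  refine ⟨l, hl, ?_⟩
  ext i
  fin_cases i
  · simpa using h₀
  · simpa using h₁

/-- Used to exclude points from the interior of a face: on a one-dimensional part, a small step in a
transversal direction `v` leaves the face. -/
theorem exists_add_smul_mem_of_mem_interior {S : Set Plane} {x : Plane} (hx : x ∈ interior S)
    (v : Plane) : ∃ ε : ℝ, 0 < ε ∧ x + ε • v ∈ S := by
  have hc : Filter.Tendsto (fun ε : ℝ => x + ε • v) (nhdsWithin 0 (Set.Ioi 0)) (nhds x) := by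
    have : Continuous fun ε : ℝ => x + ε • v := by fun_prop
    simpa using (this.tendsto 0).mono_left nhdsWithin_le_nhds
  obtain ⟨ε, hε, h⟩ := ((hc.eventually (mem_interior_iff_mem_nhds.1 hx)).and
    self_mem_nhdsWithin).exists
  exact ⟨ε, h, hε⟩

namespace SimplePolygon

variable {P : SimplePolygon n}

/-- Here `l` is the length of the edge. The edges of both examples have integer lengths, so all
directions are rational. -/
theorem direction_eq {e : Fin n} {p₀ p₁ q₀ q₁ : ℝ} (l a b : ℝ) (hl : 0 < l)
    (hab : a ^ 2 + b ^ 2 = 1) (hp : P.vertices e = !₂[p₀, p₁])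
    (hq : P.vertices (finRotate n e) = !₂[q₀, q₁]) (h₀ : q₀ - p₀ = l * a)
    (h₁ : q₁ - p₁ = l * b) : P.direction e = !₂[a, b] := by
  have h : P.vertices (finRotate n e) - P.vertices e = l • (!₂[a, b] : Plane) := by
    rw [hp, hq]
    ext i
    fin_cases i
    · simpa using h₀
    · simpa using h₁
  have hn : ‖(!₂[a, b] : Plane)‖ = 1 := by
    rw [EuclideanSpace.norm_eq]
    simp [hab]
  rw [direction, h, norm_smul, hn, Real.norm_of_nonneg hl.le, smul_smul, mul_one,
    inv_mul_cancel₀ hl.ne', one_smul]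

theorem mem_supportingLine {δ : Fin n → ℝ≥0} {e : Fin n} {a b d p₀ p₁ t : ℝ} {x : Plane}
    (hd : P.direction e = !₂[a, b]) (hp : P.vertices e = !₂[p₀, p₁]) (hδ : (δ e : ℝ) = d)
    (hab : a ^ 2 + b ^ 2 = 1) (h : a * (x 1 - p₁) - b * (x 0 - p₀) = max 0 (t - d)) :
    x ∈ P.supportingLine δ e t := by
  -- The parameter is the component of `x - p` along the edge; the hypothesis `h` prescribes the
  -- component along the inward normal.
  refine ⟨a * (x 0 - p₀) + b * (x 1 - p₁), ?_⟩
  rw [hδ, ← h, inwardNormal, hd, hp]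
  ext i
  fin_cases i
  · simp
    linear_combination -(x 0 - p₀) * hab
  · simp
    linear_combination -(x 1 - p₁) * hab

end SimplePolygon

theorem fragments_at_two (a b : Fin n × (ℝ → Plane)) (t : ℝ) :
    fragments (KineticPolygon.at [a, b] t) = [(a.1, a.2 t, b.2 t), (b.1, b.2 t, a.2 t)] := rfl

theorem fragments_at_three (a b c : Fin n × (ℝ → Plane)) (t : ℝ) :
    fragments (KineticPolygon.at [a, b, c] t) =
      [(a.1, a.2 t, b.2 t), (b.1, b.2 t, c.2 t), (c.1, c.2 t, a.2 t)] := rfl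

theorem fragments_at_four (a b c d : Fin n × (ℝ → Plane)) (t : ℝ) :
    fragments (KineticPolygon.at [a, b, c, d] t) =
      [(a.1, a.2 t, b.2 t), (b.1, b.2 t, c.2 t), (c.1, c.2 t, d.2 t), (d.1, d.2 t, a.2 t)] := rfl

theorem fragments_at_five (a b c d e : Fin n × (ℝ → Plane)) (t : ℝ) :
    fragments (KineticPolygon.at [a, b, c, d, e] t) =
      [(a.1, a.2 t, b.2 t), (b.1, b.2 t, c.2 t), (c.1, c.2 t, d.2 t), (d.1, d.2 t, e.2 t),
        (e.1, e.2 t, a.2 t)] := rfl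

theorem corners_two (a b : Fin n × (ℝ → Plane)) :
    KineticPolygon.corners [a, b] = [(a.1, b.1, b.2), (b.1, a.1, a.2)] := rfl

theorem corners_three (a b c : Fin n × (ℝ → Plane)) :
    KineticPolygon.corners [a, b, c] =
      [(a.1, b.1, b.2), (b.1, c.1, c.2), (c.1, a.1, a.2)] := rfl

theorem corners_four (a b c d : Fin n × (ℝ → Plane)) :
    KineticPolygon.corners [a, b, c, d] =
      [(a.1, b.1, b.2), (b.1, c.1, c.2), (c.1, d.1, d.2), (d.1, a.1, a.2)] := rfl

theorem corners_five (a b c d e : Fin n × (ℝ → Plane)) :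
    KineticPolygon.corners [a, b, c, d, e] =
      [(a.1, b.1, b.2), (b.1, c.1, c.2), (c.1, d.1, d.2), (d.1, e.1, e.2), (e.1, a.1, a.2)] :=
  rfl

/-- In a stage of duration zero only the incidences have to be checked. -/
theorem isMotion_self {P : SimplePolygon n} {δ : Fin n → ℝ≥0} {t : ℝ}
    {W : List (KineticPolygon n)}
    (h : ∀ L ∈ W, ∀ c ∈ L.corners,
      c.2.2 t ∈ P.supportingLine δ c.1 t ∧ c.2.2 t ∈ P.supportingLine δ c.2.1 t) :
    IsMotion P δ t t W where
  continuous L _ c _ := by simp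
  incident L hL c hc τ hτ := by
    obtain rfl : τ = t := by simpa using hτ
    exact h L hL c hc
  bisector L _ c _ _ τ hτ := by
    obtain rfl : τ = t := by simpa using hτ
    simp
  oriented τ hτ := by simp at hτ
  planar τ hτ := by simp at hτ

/-! ### A face with empty interior, and one whose interior is far from its edge -/

namespace Dart

/-- The vertices of a quadrilateral with a reflex vertex at `(4, 0)`. -/
def vertices : Fin 4 → Plane := ![!₂[0, 0], !₂[4, 0], !₂[24, -15], !₂[24, 18]]

/-- The wavefront until time 12. -/
def quadrilateral : List (KineticPolygon 4) :=
  [[(0, fun t => !₂[5 * t / 3, 0]), (1, fun t => !₂[4 + 5 * t / 3, 0]),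
    (2, fun t => !₂[24, -15 + 5 * t / 4]), (3, fun t => !₂[24, 18 - 5 * t / 4])]]

/-- The wavefront from time 12 on. -/
def triangle : List (KineticPolygon 4) :=
  [[(2, fun t => !₂[24, t - 12]), (3, fun t => !₂[24, 18 - 5 * t / 4]),
    (0, fun t => !₂[3 * t - 16, t - 12])]]

/-- The collapsed wavefront. -/
def digon : List (KineticPolygon 4) :=
  [[(3, fun _ => !₂[24, 4 / 3]), (0, fun _ => !₂[24, 4 / 3])]]

/-- Time 0 is included because that case also proves the input polygon simple. -/
theorem pairwise_quadrilateral {t : ℝ} (ht : t ∈ Set.Ico (0 : ℝ) 12) :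
    (fragmentsAt quadrilateral t).Pairwise NonCrossing := by
  obtain ⟨h0, h1⟩ := ht
  simp only [fragmentsAt, quadrilateral, List.flatMap_cons, List.flatMap_nil, fragments_at_four,
    List.append_nil, List.pairwise_cons, List.mem_cons, List.not_mem_nil, or_false,
    forall_eq_or_imp, forall_eq, IsEmpty.forall_iff, implies_true, and_true, List.Pairwise.nil]
  refine ⟨⟨?_, ?_, NonCrossing.symm ?_⟩, ⟨?_, NonCrossing.symm ?_⟩, ?_⟩
  · apply nonCrossing_of_cross_ne_zero
    apply ne_of_lt
    simp [cross]
    linarith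
  · apply nonCrossing_of_separated 1 0 (4 + 5 * t / 3) <;> simp <;> linarith
  · apply nonCrossing_of_cross_ne_zero
    apply ne_of_gt
    simp [cross]
    linarith
  · apply nonCrossing_of_cross_ne_zero
    apply ne_of_gt
    simp [cross]
    apply mul_pos <;> linarith
  -- The separating line is the supporting line of edge 3 at time `t`.
  · apply nonCrossing_of_separated 3 (-4) (5 * t) <;> simp <;> linarith
  · apply nonCrossing_of_cross_ne_zero
    apply ne_of_gt
    simp [cross]
    nlinarith

theorem pairwise_triangle {t : ℝ} (ht : t ∈ Set.Ico (12 : ℝ) (40 / 3)) :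
    (fragmentsAt triangle t).Pairwise NonCrossing := by
  obtain ⟨h0, h1⟩ := ht
  simp only [fragmentsAt, triangle, List.flatMap_cons, List.flatMap_nil, fragments_at_three,
    List.append_nil, List.pairwise_cons, List.mem_cons, List.not_mem_nil, or_false,
    forall_eq_or_imp, forall_eq, IsEmpty.forall_iff, implies_true, and_true, List.Pairwise.nil]
  refine ⟨⟨?_, NonCrossing.symm ?_⟩, ?_⟩ <;>
  · apply nonCrossing_of_cross_ne_zero
    apply ne_of_gt
    simp [cross]
    nlinarith

theorem injective_vertices : Function.Injective vertices := by
  intro i j h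
  have h0 := congrArg (fun p : Plane => p 0) h
  have h1 := congrArg (fun p : Plane => p 1) h
  fin_cases i <;> fin_cases j <;>
    first
    | rfl
    | (norm_num [vertices] at h0; done)
    | (norm_num [vertices] at h1)

/-- The quadrilateral. -/
def polygon : SimplePolygon 4 where
  vertices := vertices
  three_le := by norm_num
  nondegenerate i h := by
    have : i ≠ finRotate 4 i := by clear h; revert i; decide
    exact this (injective_vertices h)
  edges_inter := by
    refine edges_inter_of_nonCrossing _ injective_vertices fun i j hij => ?_
    have := pairwise_quadrilateral (t := 0) (by norm_num)
    have h : fragmentsAt quadrilateral 0 =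
        List.ofFn fun i => (i, vertices i, vertices (finRotate 4 i)) := by
      simp [fragmentsAt, quadrilateral, fragments_at_four, vertices, finRotate_apply]
    rw [h, List.pairwise_ofFn] at this
    exact this hij
  counterclockwise := by
    simp [Fin.sum_univ_four, vertices, cross, finRotate_apply]
    norm_num

/-- The edge on the line `x = 24` remains stationary until the wavefront has collapsed. -/
def weight : Fin 4 → ℝ≥0 := ![12, 0, 14, 0]

theorem weight_zero : (weight 0 : ℝ) = 12 := by simp [weight]

theorem weight_one : (weight 1 : ℝ) = 0 := by simp [weight]

theorem weight_two : (weight 2 : ℝ) = 14 := by simp [weight]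

theorem weight_three : (weight 3 : ℝ) = 0 := by simp [weight]

theorem direction_zero : polygon.direction 0 = !₂[1, 0] :=
  SimplePolygon.direction_eq 4 _ _ (by norm_num) (by norm_num) rfl rfl (by norm_num) (by norm_num)

theorem direction_one : polygon.direction 1 = !₂[4 / 5, -3 / 5] :=
  SimplePolygon.direction_eq 25 _ _ (by norm_num) (by norm_num) rfl rfl (by norm_num) (by norm_num)

theorem direction_two : polygon.direction 2 = !₂[0, 1] :=
  SimplePolygon.direction_eq 33 _ _ (by norm_num) (by norm_num) rfl rfl (by norm_num) (by norm_num)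

theorem direction_three : polygon.direction 3 = !₂[-4 / 5, -3 / 5] :=
  SimplePolygon.direction_eq 30 _ _ (by norm_num) (by norm_num) rfl rfl (by norm_num) (by norm_num)

theorem mem_line_zero {t : ℝ} {x : Plane} (h : x 1 = max 0 (t - 12)) :
    x ∈ polygon.supportingLine weight 0 t :=
  SimplePolygon.mem_supportingLine direction_zero rfl weight_zero (by norm_num) (by simpa using h)

theorem mem_line_one {t : ℝ} {x : Plane} (h0 : 0 ≤ t) (h : 4 * x 1 + 3 * (x 0 - 4) = 5 * t) :
    x ∈ polygon.supportingLine weight 1 t :=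
  SimplePolygon.mem_supportingLine direction_one rfl weight_one (by norm_num) (by
    rw [max_eq_right (by simpa using h0)]
    linarith)

theorem mem_line_two {t : ℝ} {x : Plane} (h0 : t ≤ 14) (h : x 0 = 24) :
    x ∈ polygon.supportingLine weight 2 t :=
  SimplePolygon.mem_supportingLine direction_two rfl weight_two (by norm_num) (by
    rw [max_eq_left (by simpa using h0)]
    linarith)

theorem mem_line_three {t : ℝ} {x : Plane} (h0 : 0 ≤ t)
    (h : 3 * (x 0 - 24) - 4 * (x 1 - 18) = 5 * t) :
    x ∈ polygon.supportingLine weight 3 t :=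
  SimplePolygon.mem_supportingLine direction_three rfl weight_three (by norm_num) (by
    rw [max_eq_right (by simpa using h0)]
    linarith)

theorem isMotion_quadrilateral : IsMotion polygon weight 0 12 quadrilateral where
  continuous := by
    simp only [quadrilateral, corners_four, List.forall_mem_cons, List.not_mem_nil,
      IsEmpty.forall_iff, implies_true, and_true]
    refine ⟨?_, ?_, ?_, ?_⟩ <;> fun_prop
  incident := by
    simp only [quadrilateral, corners_four, List.forall_mem_cons, List.not_mem_nil,
      IsEmpty.forall_iff, implies_true, and_true]
    refine ⟨?_, ?_, ?_, ?_⟩ <;> rintro τ ⟨h0, h1⟩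
    · exact ⟨mem_line_zero (by simp [h1]), mem_line_one h0 (by simp; ring)⟩
    · exact ⟨mem_line_one h0 (by simp; ring), mem_line_two (by linarith) rfl⟩
    · exact ⟨mem_line_two (by linarith) rfl, mem_line_three h0 (by simp; ring)⟩
    · exact ⟨mem_line_three h0 (by simp; ring), mem_line_zero (by simp [h1])⟩
  bisector := by
    simp only [quadrilateral, corners_four, List.forall_mem_cons, List.not_mem_nil,
      IsEmpty.forall_iff, implies_true, and_true, direction_zero, direction_one, direction_two,
      direction_three]
    -- No two adjacent fragments are parallel, so the condition is vacuous.
    norm_num [cross]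
  oriented := by
    rintro τ ⟨h0, h1⟩
    simp only [quadrilateral, fragmentsAt, fragments_at_four, List.forall_mem_cons,
      List.flatMap_cons, List.flatMap_nil, List.append_nil, List.not_mem_nil,
      IsEmpty.forall_iff, implies_true, and_true, direction_zero, direction_one, direction_two,
      direction_three]
    -- The constants are the fragment lengths. The bottom fragment keeps length 4: it slides along
    -- its line, since both of its end points move at speed `5 / 3`.
    refine ⟨exists_pos_smul_of_coord 4 _ _ ?_ ?_ ?_,
      exists_pos_smul_of_coord (25 - 25 * τ / 12) _ _ ?_ ?_ ?_,
      exists_pos_smul_of_coord (33 - 5 * τ / 2) _ _ ?_ ?_ ?_,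
      exists_pos_smul_of_coord (30 - 25 * τ / 12) _ _ ?_ ?_ ?_⟩ <;> simp <;> linarith
  planar τ hτ := pairwise_quadrilateral ⟨hτ.1.le, hτ.2⟩

theorem isMotion_triangle : IsMotion polygon weight 12 (40 / 3) triangle where
  continuous := by
    simp only [triangle, corners_three, List.forall_mem_cons, List.not_mem_nil,
      IsEmpty.forall_iff, implies_true, and_true]
    refine ⟨?_, ?_, ?_⟩ <;> fun_prop
  incident := by
    simp only [triangle, corners_three, List.forall_mem_cons, List.not_mem_nil,
      IsEmpty.forall_iff, implies_true, and_true]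
    refine ⟨?_, ?_, ?_⟩ <;> rintro τ ⟨h0, h1⟩
    · exact ⟨mem_line_two (by linarith) rfl, mem_line_three (by linarith) (by simp; ring)⟩
    · exact ⟨mem_line_three (by linarith) (by simp; ring), mem_line_zero (by simp [h0])⟩
    · exact ⟨mem_line_zero (by simp [h0]), mem_line_two (by linarith) rfl⟩
  bisector := by
    simp only [triangle, corners_three, List.forall_mem_cons, List.not_mem_nil,
      IsEmpty.forall_iff, implies_true, and_true, direction_zero, direction_two,
      direction_three]
    norm_num [cross]
  oriented := by
    rintro τ ⟨h0, h1⟩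
    simp only [triangle, fragmentsAt, fragments_at_three, List.forall_mem_cons,
      List.flatMap_cons, List.flatMap_nil, List.append_nil, List.not_mem_nil,
      IsEmpty.forall_iff, implies_true, and_true, direction_zero, direction_two,
      direction_three]
    refine ⟨exists_pos_smul_of_coord (30 - 9 * τ / 4) _ _ ?_ ?_ ?_,
      exists_pos_smul_of_coord (50 - 15 * τ / 4) _ _ ?_ ?_ ?_,
      exists_pos_smul_of_coord (40 - 3 * τ) _ _ ?_ ?_ ?_⟩ <;> simp <;> linarith
  planar τ hτ := pairwise_triangle ⟨hτ.1.le, hτ.2⟩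

theorem isMotion_digon : IsMotion polygon weight (40 / 3) (40 / 3) digon := by
  apply isMotion_self
  simp only [digon, corners_two, List.forall_mem_cons, List.not_mem_nil,
    IsEmpty.forall_iff, implies_true, and_true]
  have h3 : (!₂[24, 4 / 3] : Plane) ∈ polygon.supportingLine weight 3 (40 / 3) :=
    mem_line_three (by norm_num) (by norm_num)
  have h0 : (!₂[24, 4 / 3] : Plane) ∈ polygon.supportingLine weight 0 (40 / 3) :=
    mem_line_zero (by norm_num)
  exact ⟨⟨h3, h0⟩, h0, h3⟩

/-- The stages of the propagation. -/
def wavefront : ℕ → List (KineticPolygon 4)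
  | 0 => quadrilateral
  | 1 => triangle
  | 2 => triangle
  | 3 => digon
  | _ => []

/-- The start times of the stages. -/
def time : ℕ → ℝ
  | 0 => 0
  | 1 => 12
  | 2 => 12
  | _ => 40 / 3

/-- At time 12 the second edge vanishes. -/
theorem edgeEvent_quadrilateral : WavefrontEvent polygon weight 12
    (quadrilateral.map fun L => L.at 12) (triangle.map fun L => L.at 12) := by
  -- Rotation by one brings the vanished fragment of edge 1 to the head of the list.
  have h := WavefrontEvent.polygon (P := polygon) (δ := weight) (t := 12) [] []
    [(0, !₂[20, 0]), (1, !₂[24, 0]), (2, !₂[24, 0]), (3, !₂[24, 3])] _ _ ⟨1, rfl⟩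
    (PolygonEvent.edge 1 2 !₂[24, 0] [(3, !₂[24, 3]), (0, !₂[20, 0])])
  convert h using 1 <;> norm_num [quadrilateral, triangle, KineticPolygon.at]

theorem edgeEvent_triangle : WavefrontEvent polygon weight (40 / 3)
    (triangle.map fun L => L.at (40 / 3)) (digon.map fun L => L.at (40 / 3)) := by
  have h := WavefrontEvent.polygon (P := polygon) (δ := weight) (t := 40 / 3) [] []
    _ _ _ (List.IsRotated.refl _)
    (PolygonEvent.edge 2 3 !₂[24, 4 / 3] [(0, !₂[24, 4 / 3])])
  convert h using 1 <;> norm_num [digon, triangle, KineticPolygon.at]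

theorem collapse_digon : WavefrontEvent polygon weight (40 / 3)
    (digon.map fun L => L.at (40 / 3)) [] :=
  WavefrontEvent.polygon [] [] _ _ [] (List.IsRotated.refl _) (PolygonEvent.collapse _ le_rfl)

/-- A propagation in which the fragment of the bottom edge has left this edge by the time it starts
to move. -/
def propagation : Propagation polygon weight where
  numStages := 4
  time := time
  wavefront := wavefront
  time_zero := rfl
  time_le k hk := by interval_cases k <;> norm_num [time]
  initial := by
    simp [wavefront, time, quadrilateral, KineticPolygon.at, polygon, vertices]
  motion k hk := by
    interval_cases k
    · exact isMotion_quadrilateral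
    -- Zero-duration stage between the edge event and the start of the bottom edge, both at time 12.
    · refine isMotion_self fun L hL c hc => ?_
      exact isMotion_triangle.incident L hL c hc 12 (by norm_num [time])
    · exact isMotion_triangle
    · exact isMotion_digon
  event k hk := by
    interval_cases k
    · exact edgeEvent_quadrilateral
    · exact WavefrontEvent.speedChange 0 weight_zero _
    · exact edgeEvent_triangle
    · exact collapse_digon
  final := rfl

/-- The weight 14 exceeds the final time `40 / 3`, so this edge never moves. -/
theorem coord_eq_of_mem_face_two {x : Plane} (hx : x ∈ propagation.face 2) : x 0 = 24 := by
  obtain ⟨k, hk, τ, hτ, f, hf, he, hx⟩ := propagation.mem_face.1 hx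
  obtain ⟨θ, -, hx⟩ := exists_coord_of_mem_segment hx
  rw [hx 0]
  change k < 4 at hk
  change f ∈ fragmentsAt (wavefront k) τ at hf
  interval_cases k <;>
  · simp [wavefront, quadrilateral, triangle, digon, fragmentsAt, fragments_at_four,
      fragments_at_three, fragments_at_two] at hf
    rcases hf with rfl | rfl | rfl | rfl <;> simp at he ⊢

theorem interior_face_two : interior (propagation.face 2) = ∅ := by
  refine Set.eq_empty_of_forall_notMem fun x hx => ?_
  obtain ⟨ε, hε, h⟩ := exists_add_smul_mem_of_mem_interior hx !₂[1, 0]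
  have h1 := coord_eq_of_mem_face_two (interior_subset hx)
  have h2 := coord_eq_of_mem_face_two h
  simp at h2
  linarith

/-- Until time 12 the fragment lies on `y = 0`; from then on its start point has abscissa `3 * t -
16 ≥ 20`, and the fragment extends to the right from there. -/
theorem coord_of_mem_face_zero {x : Plane} (hx : x ∈ propagation.face 0) :
    x 1 = 0 ∨ 20 ≤ x 0 := by
  obtain ⟨k, hk, τ, hτ, f, hf, he, hx⟩ := propagation.mem_face.1 hx
  obtain ⟨θ, ⟨h0, h1⟩, hx⟩ := exists_coord_of_mem_segment hx
  rw [hx 0, hx 1]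
  change k < 4 at hk
  change f ∈ fragmentsAt (wavefront k) τ at hf
  change time k ≤ τ ∧ τ ≤ time (k + 1) at hτ
  interval_cases k <;>
  simp [wavefront, quadrilateral, triangle, digon, fragmentsAt, fragments_at_four,
      fragments_at_three, fragments_at_two, time] at hf hτ <;>
  rcases hf with rfl | rfl | rfl | rfl <;> simp at he ⊢ <;>
  first
  | (norm_num; done)
  | (right; nlinarith [mul_nonneg h0 (sub_nonneg.2 hτ.2)])

theorem interior_face_zero_subset : interior (propagation.face 0) ⊆ {x | 20 ≤ x 0} := by
  intro x hx
  by_contra hlt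
  rw [Set.mem_ofPred_eq, not_le] at hlt
  -- Upwards to leave the line `y = 0`, and to the left to stay in `x < 20`.
  obtain ⟨ε, hε, h⟩ := exists_add_smul_mem_of_mem_interior hx !₂[-1, 1]
  have h1 := (coord_of_mem_face_zero (interior_subset hx)).resolve_right (by linarith)
  have h2 := coord_of_mem_face_zero h
  simp [h1, hε.ne'] at h2
  linarith

theorem nonempty_interior_face_zero : (interior (propagation.face 0)).Nonempty := by
  -- The open triangle swept after time 12: the fragment at height `y` is that of time `y + 12` and
  -- runs from `20 + 3 * y` to `24`.
  let U : Set Plane := {x | 0 < x 1 ∧ x 1 < 4 / 3 ∧ 20 + 3 * x 1 < x 0 ∧ x 0 < 24}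
  have c0 : Continuous fun x : Plane => x 0 := by fun_prop
  have c1 : Continuous fun x : Plane => x 1 := by fun_prop
  have hU : IsOpen U := (isOpen_lt continuous_const c1).inter ((isOpen_lt c1 continuous_const).inter
    ((isOpen_lt (continuous_const.add (continuous_const.mul c1)) c0).inter
      (isOpen_lt c0 continuous_const)))
  have hsub : U ⊆ propagation.face 0 := by
    rintro x ⟨h1, h2, h3, h4⟩
    refine propagation.mem_face.2 ⟨2, by decide, x 1 + 12, ?_,
      (0, !₂[3 * (x 1 + 12) - 16, x 1 + 12 - 12], !₂[24, x 1 + 12 - 12]), ?_, rfl, ?_⟩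
    · change (12 : ℝ) ≤ x 1 + 12 ∧ x 1 + 12 ≤ 40 / 3
      constructor <;> linarith
    · change _ ∈ fragmentsAt triangle _
      simp [triangle, fragmentsAt, fragments_at_three]
    · refine mem_segment_of_coord (θ := (x 0 - (20 + 3 * x 1)) / (4 - 3 * x 1)) ⟨?_, ?_⟩ ?_ ?_
      · exact div_nonneg (by linarith) (by linarith)
      · rw [div_le_one (by linarith)]
        linarith
      · have : 4 - 3 * x 1 ≠ 0 := by linarith
        simp
        field_simp
        ring
      · simp
  refine ⟨!₂[23, 1 / 2], interior_maximal hsub hU ?_⟩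
  norm_num [U]

theorem disjoint_closure_interior_face_zero :
    Disjoint (closure (interior (propagation.face 0))) (polygon.edgeSet ℝ 0) := by
  have hcl : IsClosed {x : Plane | 20 ≤ x 0} := isClosed_le (by fun_prop) (by fun_prop)
  refine Set.disjoint_left.2 fun x hx he => ?_
  have h20 : 20 ≤ x 0 := closure_minimal interior_face_zero_subset hcl hx
  rw [Polygon.edgeSet, affineSegment_eq_segment] at he
  have h4 := le_of_mem_segment 1 0 4 (by norm_num [polygon, vertices])
    (by norm_num [polygon, vertices, finRotate_apply]) he
  linarith

end Dart

/-! ### A face with disconnected interior -/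

namespace Pentagon

/-- The vertices of a pentagon with a reflex vertex at `(0, 5)`, opposite to the bottom edge. -/
def vertices : Fin 5 → Plane := ![!₂[-3, 0], !₂[3, 0], !₂[3, 9], !₂[0, 5], !₂[-3, 9]]

/-- The wavefront until time 3. -/
def pentagon : List (KineticPolygon 5) :=
  [[(0, fun _ => !₂[-3, 0]), (1, fun _ => !₂[3, 0]), (2, fun t => !₂[3, 9 - 5 * t / 3]),
    (3, fun t => !₂[0, 5 - 5 * t / 3]), (4, fun t => !₂[-3, 9 - 5 * t / 3])]]

/-- The left wavefront polygon from time 3 on. -/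
def leftTriangle : KineticPolygon 5 :=
  [(3, fun t => !₂[6 - 2 * t, t - 3]), (4, fun t => !₂[-3, 9 - 5 * t / 3]),
    (0, fun t => !₂[-3, t - 3])]

/-- The right wavefront polygon from time 3 on. -/
def rightTriangle : KineticPolygon 5 :=
  [(0, fun t => !₂[2 * t - 6, t - 3]), (1, fun t => !₂[3, t - 3]),
    (2, fun t => !₂[3, 9 - 5 * t / 3])]

/-- The collapsed left wavefront polygon. -/
def leftDigon : KineticPolygon 5 :=
  [(4, fun _ => !₂[-3, 3 / 2]), (0, fun _ => !₂[-3, 3 / 2])]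

/-- The collapsed right wavefront polygon. -/
def rightDigon : KineticPolygon 5 :=
  [(1, fun _ => !₂[3, 3 / 2]), (2, fun _ => !₂[3, 3 / 2])]

theorem pairwise_pentagon {t : ℝ} (ht : t ∈ Set.Ico (0 : ℝ) 3) :
    (fragmentsAt pentagon t).Pairwise NonCrossing := by
  obtain ⟨h0, h1⟩ := ht
  simp only [fragmentsAt, pentagon, List.flatMap_cons, List.flatMap_nil, fragments_at_five,
    List.append_nil, List.pairwise_cons, List.mem_cons, List.not_mem_nil, or_false,
    forall_eq_or_imp, forall_eq, IsEmpty.forall_iff, implies_true, and_true, List.Pairwise.nil]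
  refine ⟨⟨?_, ?_, ?_, NonCrossing.symm ?_⟩, ⟨?_, NonCrossing.symm ?_, NonCrossing.symm ?_⟩,
    ⟨?_, NonCrossing.symm ?_⟩, ?_⟩
  · apply nonCrossing_of_cross_ne_zero
    apply ne_of_gt
    simp [cross]
    linarith
  -- The reflex vertex stays strictly above the bottom line until time 3.
  · apply nonCrossing_of_separated 0 1 0 <;> simp <;> linarith
  · apply nonCrossing_of_separated 0 1 0 <;> simp <;> linarith
  · apply nonCrossing_of_cross_ne_zero
    apply ne_of_gt
    simp [cross]
    linarith
  · apply nonCrossing_of_cross_ne_zero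
    apply ne_of_gt
    simp [cross]
    linarith
  · apply nonCrossing_of_separated 1 0 0 <;> simp
  · apply nonCrossing_of_separated 1 0 0 <;> simp
  · apply nonCrossing_of_cross_ne_zero
    apply ne_of_lt
    simp [cross]
    linarith
  · apply nonCrossing_of_separated 1 0 (-3) <;> simp
  · apply nonCrossing_of_cross_ne_zero
    apply ne_of_gt
    simp [cross]
    linarith

/-- Time 3 has to be excluded, since the two triangles then touch in the origin. Later the axis `x =
0` separates them. -/
theorem pairwise_triangles {t : ℝ} (ht : t ∈ Set.Ioo (3 : ℝ) (9 / 2)) :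
    (fragmentsAt [leftTriangle, rightTriangle] t).Pairwise NonCrossing := by
  obtain ⟨h0, h1⟩ := ht
  rw [fragmentsAt, List.flatMap_cons, List.flatMap_cons, List.flatMap_nil, List.append_nil,
    List.pairwise_append]
  simp only [leftTriangle, rightTriangle, fragments_at_three,
    List.pairwise_cons, List.mem_cons, List.not_mem_nil, or_false,
    forall_eq_or_imp, forall_eq, IsEmpty.forall_iff, implies_true, and_true, List.Pairwise.nil]
  refine ⟨⟨⟨?_, NonCrossing.symm ?_⟩, ?_⟩, ⟨⟨?_, NonCrossing.symm ?_⟩, ?_⟩,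
    ⟨?_, ?_, ?_⟩, ⟨?_, ?_, ?_⟩, ⟨?_, ?_, ?_⟩⟩
  iterate 6
    · apply nonCrossing_of_cross_ne_zero
      apply ne_of_gt
      simp [cross]
      nlinarith
  all_goals apply nonCrossing_of_separated 1 0 0 <;> simp <;> linarith

theorem injective_vertices : Function.Injective vertices := by
  intro i j h
  have h0 := congrArg (fun p : Plane => p 0) h
  have h1 := congrArg (fun p : Plane => p 1) h
  fin_cases i <;> fin_cases j <;>
    first
    | rfl
    | (norm_num [vertices] at h0; done)
    | (norm_num [vertices] at h1)

/-- The pentagon. -/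
def polygon : SimplePolygon 5 where
  vertices := vertices
  three_le := by norm_num
  nondegenerate i h := by
    have : i ≠ finRotate 5 i := by clear h; revert i; decide
    exact this (injective_vertices h)
  edges_inter := by
    refine edges_inter_of_nonCrossing _ injective_vertices fun i j hij => ?_
    have := pairwise_pentagon (t := 0) (by norm_num)
    have h : fragmentsAt pentagon 0 =
        List.ofFn fun i => (i, vertices i, vertices (finRotate 5 i)) := by
      simp [fragmentsAt, pentagon, fragments_at_five, vertices, finRotate_apply]
    rw [h, List.pairwise_ofFn] at this
    exact this hij
  counterclockwise := by
    simp [Fin.sum_univ_five, vertices, cross, finRotate_apply]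
    norm_num

/-- The two walls remain stationary until all wavefront polygons have collapsed. -/
def weight : Fin 5 → ℝ≥0 := ![3, 5, 0, 0, 5]

theorem weight_zero : (weight 0 : ℝ) = 3 := by simp [weight]

theorem weight_one : (weight 1 : ℝ) = 5 := by simp [weight]

theorem weight_two : (weight 2 : ℝ) = 0 := by simp [weight]

theorem weight_three : (weight 3 : ℝ) = 0 := by simp [weight]

theorem weight_four : (weight 4 : ℝ) = 5 := by simp [weight]

theorem direction_zero : polygon.direction 0 = !₂[1, 0] :=
  SimplePolygon.direction_eq 6 _ _ (by norm_num) (by norm_num) rfl rfl (by norm_num) (by norm_num)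

theorem direction_one : polygon.direction 1 = !₂[0, 1] :=
  SimplePolygon.direction_eq 9 _ _ (by norm_num) (by norm_num) rfl rfl (by norm_num) (by norm_num)

theorem direction_two : polygon.direction 2 = !₂[-3 / 5, -4 / 5] :=
  SimplePolygon.direction_eq 5 _ _ (by norm_num) (by norm_num) rfl rfl (by norm_num) (by norm_num)

theorem direction_three : polygon.direction 3 = !₂[-3 / 5, 4 / 5] :=
  SimplePolygon.direction_eq 5 _ _ (by norm_num) (by norm_num) rfl rfl (by norm_num) (by norm_num)

theorem direction_four : polygon.direction 4 = !₂[0, -1] :=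
  SimplePolygon.direction_eq 9 _ _ (by norm_num) (by norm_num) rfl rfl (by norm_num) (by norm_num)

theorem mem_line_zero {t : ℝ} {x : Plane} (h : x 1 = max 0 (t - 3)) :
    x ∈ polygon.supportingLine weight 0 t :=
  SimplePolygon.mem_supportingLine direction_zero rfl weight_zero (by norm_num) (by simpa using h)

theorem mem_line_one {t : ℝ} {x : Plane} (h0 : t ≤ 5) (h : x 0 = 3) :
    x ∈ polygon.supportingLine weight 1 t :=
  SimplePolygon.mem_supportingLine direction_one rfl weight_one (by norm_num) (by
    rw [max_eq_left (by simpa using h0)]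
    linarith)

theorem mem_line_two {t : ℝ} {x : Plane} (h0 : 0 ≤ t)
    (h : 4 * (x 0 - 3) - 3 * (x 1 - 9) = 5 * t) : x ∈ polygon.supportingLine weight 2 t :=
  SimplePolygon.mem_supportingLine direction_two rfl weight_two (by norm_num) (by
    rw [max_eq_right (by simpa using h0)]
    linarith)

theorem mem_line_three {t : ℝ} {x : Plane} (h0 : 0 ≤ t)
    (h : -(4 * x 0) - 3 * (x 1 - 5) = 5 * t) : x ∈ polygon.supportingLine weight 3 t :=
  SimplePolygon.mem_supportingLine direction_three rfl weight_three (by norm_num) (by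
    rw [max_eq_right (by simpa using h0)]
    linarith)

theorem mem_line_four {t : ℝ} {x : Plane} (h0 : t ≤ 5) (h : x 0 = -3) :
    x ∈ polygon.supportingLine weight 4 t :=
  SimplePolygon.mem_supportingLine direction_four rfl weight_four (by norm_num) (by
    rw [max_eq_left (by simpa using h0)]
    linarith)

theorem isMotion_pentagon : IsMotion polygon weight 0 3 pentagon where
  continuous := by
    simp only [pentagon, corners_five, List.forall_mem_cons, List.not_mem_nil,
      IsEmpty.forall_iff, implies_true, and_true]
    refine ⟨?_, ?_, ?_, ?_, ?_⟩ <;> fun_prop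
  incident := by
    simp only [pentagon, corners_five, List.forall_mem_cons, List.not_mem_nil,
      IsEmpty.forall_iff, implies_true, and_true]
    refine ⟨?_, ?_, ?_, ?_, ?_⟩ <;> rintro τ ⟨h0, h1⟩
    · exact ⟨mem_line_zero (by simp [h1]), mem_line_one (by linarith) rfl⟩
    · exact ⟨mem_line_one (by linarith) rfl, mem_line_two h0 (by simp; ring)⟩
    · exact ⟨mem_line_two h0 (by simp; ring), mem_line_three h0 (by simp; ring)⟩
    · exact ⟨mem_line_three h0 (by simp; ring), mem_line_four (by linarith) rfl⟩
    · exact ⟨mem_line_four (by linarith) rfl, mem_line_zero (by simp [h1])⟩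
  bisector := by
    simp only [pentagon, corners_five, List.forall_mem_cons, List.not_mem_nil,
      IsEmpty.forall_iff, implies_true, and_true, direction_zero, direction_one, direction_two,
      direction_three, direction_four]
    norm_num [cross]
  oriented := by
    rintro τ ⟨h0, h1⟩
    simp only [pentagon, fragmentsAt, fragments_at_five, List.forall_mem_cons,
      List.flatMap_cons, List.flatMap_nil, List.append_nil, List.not_mem_nil,
      IsEmpty.forall_iff, implies_true, and_true, direction_zero, direction_one, direction_two,
      direction_three, direction_four]
    refine ⟨exists_pos_smul_of_coord 6 _ _ ?_ ?_ ?_,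
      exists_pos_smul_of_coord (9 - 5 * τ / 3) _ _ ?_ ?_ ?_,
      exists_pos_smul_of_coord 5 _ _ ?_ ?_ ?_,
      exists_pos_smul_of_coord 5 _ _ ?_ ?_ ?_,
      exists_pos_smul_of_coord (9 - 5 * τ / 3) _ _ ?_ ?_ ?_⟩ <;> norm_num <;> linarith
  planar τ hτ := pairwise_pentagon ⟨hτ.1.le, hτ.2⟩

theorem isMotion_triangles :
    IsMotion polygon weight 3 (9 / 2) [leftTriangle, rightTriangle] where
  continuous := by
    simp only [leftTriangle, rightTriangle, corners_three, List.forall_mem_cons,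
      List.not_mem_nil, IsEmpty.forall_iff, implies_true, and_true]
    refine ⟨⟨?_, ?_, ?_⟩, ?_, ?_, ?_⟩ <;> fun_prop
  incident := by
    simp only [leftTriangle, rightTriangle, corners_three, List.forall_mem_cons,
      List.not_mem_nil, IsEmpty.forall_iff, implies_true, and_true]
    refine ⟨⟨?_, ?_, ?_⟩, ?_, ?_, ?_⟩ <;> rintro τ ⟨h0, h1⟩
    · exact ⟨mem_line_three (by linarith) (by simp; ring), mem_line_four (by linarith) rfl⟩
    · exact ⟨mem_line_four (by linarith) rfl, mem_line_zero (by simp [h0])⟩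
    · exact ⟨mem_line_zero (by simp [h0]), mem_line_three (by linarith) (by simp; ring)⟩
    · exact ⟨mem_line_zero (by simp [h0]), mem_line_one (by linarith) rfl⟩
    · exact ⟨mem_line_one (by linarith) rfl, mem_line_two (by linarith) (by simp; ring)⟩
    · exact ⟨mem_line_two (by linarith) (by simp; ring), mem_line_zero (by simp [h0])⟩
  bisector := by
    simp only [leftTriangle, rightTriangle, corners_three, List.forall_mem_cons,
      List.not_mem_nil, IsEmpty.forall_iff, implies_true, and_true, direction_zero,
      direction_one, direction_two, direction_three, direction_four]
    norm_num [cross]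
  oriented := by
    rintro τ ⟨h0, h1⟩
    simp only [leftTriangle, rightTriangle, fragmentsAt, fragments_at_three,
      List.forall_mem_cons, List.flatMap_cons, List.flatMap_nil, List.append_nil,
      List.cons_append, List.nil_append, List.not_mem_nil, IsEmpty.forall_iff, implies_true,
      and_true, direction_zero, direction_one, direction_two, direction_three, direction_four]
    refine ⟨exists_pos_smul_of_coord (15 - 10 * τ / 3) _ _ ?_ ?_ ?_,
      exists_pos_smul_of_coord (12 - 8 * τ / 3) _ _ ?_ ?_ ?_,
      exists_pos_smul_of_coord (9 - 2 * τ) _ _ ?_ ?_ ?_,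
      exists_pos_smul_of_coord (9 - 2 * τ) _ _ ?_ ?_ ?_,
      exists_pos_smul_of_coord (12 - 8 * τ / 3) _ _ ?_ ?_ ?_,
      exists_pos_smul_of_coord (15 - 10 * τ / 3) _ _ ?_ ?_ ?_⟩ <;> simp <;> linarith
  planar τ hτ := pairwise_triangles hτ

theorem incident_leftDigon : ∀ c ∈ leftDigon.corners,
    c.2.2 (9 / 2) ∈ polygon.supportingLine weight c.1 (9 / 2) ∧
      c.2.2 (9 / 2) ∈ polygon.supportingLine weight c.2.1 (9 / 2) := by
  simp only [leftDigon, corners_two, List.forall_mem_cons, List.not_mem_nil,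
    IsEmpty.forall_iff, implies_true, and_true]
  have h4 : (!₂[-3, 3 / 2] : Plane) ∈ polygon.supportingLine weight 4 (9 / 2) :=
    mem_line_four (by norm_num) (by norm_num)
  have h0 : (!₂[-3, 3 / 2] : Plane) ∈ polygon.supportingLine weight 0 (9 / 2) :=
    mem_line_zero (by norm_num)
  exact ⟨⟨h4, h0⟩, h0, h4⟩

theorem incident_rightDigon : ∀ c ∈ rightDigon.corners,
    c.2.2 (9 / 2) ∈ polygon.supportingLine weight c.1 (9 / 2) ∧
      c.2.2 (9 / 2) ∈ polygon.supportingLine weight c.2.1 (9 / 2) := by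
  simp only [rightDigon, corners_two, List.forall_mem_cons, List.not_mem_nil,
    IsEmpty.forall_iff, implies_true, and_true]
  have h1 : (!₂[3, 3 / 2] : Plane) ∈ polygon.supportingLine weight 1 (9 / 2) :=
    mem_line_one (by norm_num) (by norm_num)
  have h2 : (!₂[3, 3 / 2] : Plane) ∈ polygon.supportingLine weight 2 (9 / 2) :=
    mem_line_two (by norm_num) (by norm_num)
  exact ⟨⟨h1, h2⟩, h2, h1⟩

theorem incident_rightTriangle : ∀ c ∈ rightTriangle.corners,
    c.2.2 (9 / 2) ∈ polygon.supportingLine weight c.1 (9 / 2) ∧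
      c.2.2 (9 / 2) ∈ polygon.supportingLine weight c.2.1 (9 / 2) :=
  fun c hc => isMotion_triangles.incident rightTriangle (by simp) c hc _ (by norm_num)

/-- The stages of the propagation. -/
def wavefront : ℕ → List (KineticPolygon 5)
  | 0 => pentagon
  | 1 => [leftTriangle, rightTriangle]
  | 2 => [leftTriangle, rightTriangle]
  | 3 => [leftDigon, rightTriangle]
  | 4 => [rightTriangle]
  | 5 => [rightDigon]
  | _ => []

/-- The start times of the stages. -/
def time : ℕ → ℝ
  | 0 => 0
  | 1 => 3
  | 2 => 3
  | _ => 9 / 2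

/-- At time 3 the reflex vertex reaches the bottom edge. -/
theorem splitEvent_pentagon : WavefrontEvent polygon weight 3
    (pentagon.map fun L => L.at 3) ([leftTriangle, rightTriangle].map fun L => L.at 3) := by
  have hv : (!₂[0, 0] : Plane) ∈ segment ℝ !₂[-3, 0] !₂[3, 0] :=
    mem_segment_of_coord (θ := 1 / 2) (by norm_num) (by norm_num) (by norm_num)
  -- Rotation by three makes the reflex vertex the first entry, as the split event expects.
  have h := WavefrontEvent.polygon (P := polygon) (δ := weight) (t := 3) [] []
    [(0, !₂[-3, 0]), (1, !₂[3, 0]), (2, !₂[3, 4]), (3, !₂[0, 0]), (4, !₂[-3, 4])] _ _ ⟨3, rfl⟩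
    (PolygonEvent.split 3 0 1 _ _ _ [(4, !₂[-3, 4])] [(2, !₂[3, 4])] hv)
  convert h using 1 <;> norm_num [pentagon, leftTriangle, rightTriangle, KineticPolygon.at]

theorem edgeEvent_leftTriangle : WavefrontEvent polygon weight (9 / 2)
    ([leftTriangle, rightTriangle].map fun L => L.at (9 / 2))
    ([leftDigon, rightTriangle].map fun L => L.at (9 / 2)) := by
  have h := WavefrontEvent.polygon (P := polygon) (δ := weight) (t := 9 / 2)
    [] [rightTriangle.at (9 / 2)] _ _ _ (List.IsRotated.refl _)
    (PolygonEvent.edge 3 4 !₂[-3, 3 / 2] [(0, !₂[-3, 3 / 2])])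
  convert h using 1 <;> norm_num [leftDigon, leftTriangle, KineticPolygon.at]

theorem collapse_leftDigon : WavefrontEvent polygon weight (9 / 2)
    ([leftDigon, rightTriangle].map fun L => L.at (9 / 2))
    ([rightTriangle].map fun L => L.at (9 / 2)) :=
  WavefrontEvent.polygon [] [rightTriangle.at (9 / 2)] _ _ [] (List.IsRotated.refl _)
    (PolygonEvent.collapse _ le_rfl)

theorem edgeEvent_rightTriangle : WavefrontEvent polygon weight (9 / 2)
    ([rightTriangle].map fun L => L.at (9 / 2)) ([rightDigon].map fun L => L.at (9 / 2)) := by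
  have h := WavefrontEvent.polygon (P := polygon) (δ := weight) (t := 9 / 2)
    [] [] _ _ _ (List.IsRotated.refl _)
    (PolygonEvent.edge 0 1 !₂[3, 3 / 2] [(2, !₂[3, 3 / 2])])
  convert h using 1 <;> norm_num [rightDigon, rightTriangle, KineticPolygon.at]

theorem collapse_rightDigon : WavefrontEvent polygon weight (9 / 2)
    ([rightDigon].map fun L => L.at (9 / 2)) [] :=
  WavefrontEvent.polygon [] [] _ _ [] (List.IsRotated.refl _) (PolygonEvent.collapse _ le_rfl)

/-- A propagation in which the face of the bottom edge consists of this edge and of one triangle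
on each side of its midpoint. -/
def propagation : Propagation polygon weight where
  numStages := 6
  time := time
  wavefront := wavefront
  time_zero := rfl
  time_le k hk := by interval_cases k <;> norm_num [time]
  initial := by
    simp [wavefront, time, pentagon, KineticPolygon.at, polygon, vertices]
  motion k hk := by
    interval_cases k
    · exact isMotion_pentagon
    · refine isMotion_self fun L hL c hc => ?_
      exact isMotion_triangles.incident L hL c hc 3 (by norm_num)
    · exact isMotion_triangles
    · refine isMotion_self (List.forall_mem_cons.2 ⟨incident_leftDigon,
        List.forall_mem_singleton.2 incident_rightTriangle⟩)
    · exact isMotion_self (List.forall_mem_singleton.2 incident_rightTriangle)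
    · exact isMotion_self (List.forall_mem_singleton.2 incident_rightDigon)
  event k hk := by
    interval_cases k
    · exact splitEvent_pentagon
    · exact WavefrontEvent.speedChange 0 weight_zero _
    · exact edgeEvent_leftTriangle
    · exact collapse_leftDigon
    · exact edgeEvent_rightTriangle
    · exact collapse_rightDigon
  final := rfl

/-- While it waits, the fragment is on the bottom line; once it moves, each piece stays strictly on
its own side of the vertical axis. -/
theorem fragment_zero_separated {k : ℕ} (hk : k < 6) {τ : ℝ}
    (hτ : time k ≤ τ ∧ τ ≤ time (k + 1)) {f : Fin 5 × Plane × Plane}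
    (hf : f ∈ fragmentsAt (wavefront k) τ) (he : f.1 = 0) :
    (f.2.1 1 = 0 ∧ f.2.2 1 = 0) ∨ (f.2.1 0 < 0 ∧ f.2.2 0 < 0) ∨ (0 < f.2.1 0 ∧ 0 < f.2.2 0) := by
  interval_cases k <;>
  simp [wavefront, pentagon, leftTriangle, rightTriangle, leftDigon, rightDigon, fragmentsAt,
    fragments_at_five, fragments_at_three, fragments_at_two, time] at hf hτ
  · rcases hf with rfl | rfl | rfl | rfl | rfl <;> simp at he ⊢
  · rcases hf with rfl | rfl | rfl | rfl | rfl | rfl <;> simp at he ⊢ <;> left <;> linarith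
  -- At time 3 exactly both pieces end in the origin, so strict separation fails and the first
  -- alternative is needed.
  · rcases hτ.1.eq_or_lt with h | h
    · rcases hf with rfl | rfl | rfl | rfl | rfl | rfl <;> simp at he ⊢ <;> left <;> linarith
    · rcases hf with rfl | rfl | rfl | rfl | rfl | rfl <;> simp at he ⊢
      · right
        left
        linarith
      · right
        right
        linarith
  · rcases hf with rfl | rfl | rfl | rfl | rfl <;> simp at he ⊢
    right
    right
    linarith
  · rcases hf with rfl | rfl | rfl <;> simp at he ⊢
    right
    right
    linarith
  · rcases hf with rfl | rfl <;> simp at he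

/-- The face of the bottom edge meets the vertical axis only at the origin. -/
theorem coord_of_mem_face_zero {x : Plane} (hx : x ∈ propagation.face 0) :
    x 1 = 0 ∨ x 0 ≠ 0 := by
  obtain ⟨k, hk, τ, hτ, f, hf, he, hx⟩ := propagation.mem_face.1 hx
  obtain ⟨θ, ⟨h0, h1⟩, hx⟩ := exists_coord_of_mem_segment hx
  rw [hx 0, hx 1]
  rcases fragment_zero_separated hk hτ hf he with ⟨hp, hq⟩ | ⟨hp, hq⟩ | ⟨hp, hq⟩
  · left
    simp [hp, hq]
  · right
    rcases h0.eq_or_lt with rfl | h0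
    · simpa using hp.ne
    · nlinarith [mul_pos_of_neg_of_neg hq (neg_lt_zero.2 h0)]
  · right
    rcases h0.eq_or_lt with rfl | h0
    · simpa using hp.ne'
    · nlinarith [mul_pos hq h0]

/-- The point is swept at time `x 1 + 3`, when the two pieces at this height cover `2 * x 1 ≤ |x 0|
≤ 3`. -/
theorem mem_face_zero_of_abs {x : Plane} (h0 : 0 < x 1)
    (h2 : 2 * x 1 < |x 0|) (h3 : |x 0| < 3) : x ∈ propagation.face 0 := by
  have hτ : x 1 + 3 ∈ Set.Icc (3 : ℝ) (9 / 2) := by constructor <;> linarith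
  have h : 0 < 3 - 2 * x 1 := by linarith
  rcases le_total 0 (x 0) with hx | hx
  · rw [abs_of_nonneg hx] at h2 h3
    refine propagation.mem_face.2 ⟨2, by decide, x 1 + 3, hτ,
      (0, !₂[2 * (x 1 + 3) - 6, x 1 + 3 - 3], !₂[3, x 1 + 3 - 3]), ?_, rfl, ?_⟩
    · change _ ∈ fragmentsAt [leftTriangle, rightTriangle] _
      simp [leftTriangle, rightTriangle, fragmentsAt, fragments_at_three]
    · refine mem_segment_of_coord (θ := (x 0 - 2 * x 1) / (3 - 2 * x 1)) ⟨?_, ?_⟩ ?_ ?_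
      · exact div_nonneg (by linarith) h.le
      · rw [div_le_one h]
        linarith
      · have := h.ne'
        simp
        field_simp
        ring
      · simp
  · rw [abs_of_nonpos hx] at h2 h3
    refine propagation.mem_face.2 ⟨2, by decide, x 1 + 3, hτ,
      (0, !₂[-3, x 1 + 3 - 3], !₂[6 - 2 * (x 1 + 3), x 1 + 3 - 3]), ?_, rfl, ?_⟩
    · change _ ∈ fragmentsAt [leftTriangle, rightTriangle] _
      simp [leftTriangle, rightTriangle, fragmentsAt, fragments_at_three]
    · refine mem_segment_of_coord (θ := (x 0 + 3) / (3 - 2 * x 1)) ⟨?_, ?_⟩ ?_ ?_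
      · exact div_nonneg (by linarith) h.le
      · rw [div_le_one h]
        linarith
      · have := h.ne'
        simp
        field_simp
        ring
      · simp

theorem mem_interior_face_zero {x : Plane} (h0 : 0 < x 1)
    (h2 : 2 * x 1 < |x 0|) (h3 : |x 0| < 3) : x ∈ interior (propagation.face 0) := by
  let U : Set Plane := {x | 0 < x 1 ∧ 2 * x 1 < |x 0| ∧ |x 0| < 3}
  have c0 : Continuous fun x : Plane => |x 0| := by fun_prop
  have c1 : Continuous fun x : Plane => x 1 := by fun_prop
  have hU : IsOpen U := (isOpen_lt continuous_const c1).inter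
    ((isOpen_lt (continuous_const.mul c1) c0).inter (isOpen_lt c0 continuous_const))
  exact interior_maximal (fun y hy => mem_face_zero_of_abs hy.1 hy.2.1 hy.2.2) hU
    ⟨h0, h2, h3⟩

/-- The face meets the axis only in the origin, and a vertical step from there leaves the face. So
the open half-planes on either side of the axis disconnect the interior. -/
theorem coord_ne_zero_of_mem_interior_face_zero {x : Plane}
    (hx : x ∈ interior (propagation.face 0)) : x 0 ≠ 0 := by
  intro h
  have h1 := (coord_of_mem_face_zero (interior_subset hx)).resolve_right (not_not.2 h)
  obtain ⟨ε, hε, h2⟩ := exists_add_smul_mem_of_mem_interior hx !₂[0, 1]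
  have h3 := coord_of_mem_face_zero h2
  simp [h, h1, hε.ne'] at h3

theorem nonempty_interior_face_zero : (interior (propagation.face 0)).Nonempty := by
  refine ⟨!₂[2, 1 / 2], ?_⟩
  apply mem_interior_face_zero <;> norm_num

theorem not_isPreconnected_interior_face_zero :
    ¬ IsPreconnected (interior (propagation.face 0)) := by
  intro h
  have c0 : Continuous fun x : Plane => x 0 := by fun_prop
  obtain ⟨x, -, hx, hx'⟩ := h {x | x 0 < 0} {x | 0 < x 0} (isOpen_lt c0 continuous_const)
    (isOpen_lt continuous_const c0)
    (fun x hx => lt_or_gt_of_ne (coord_ne_zero_of_mem_interior_face_zero hx))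
    ⟨!₂[-2, 1 / 2], by apply mem_interior_face_zero <;> norm_num, by norm_num⟩
    ⟨!₂[2, 1 / 2], by apply mem_interior_face_zero <;> norm_num, by norm_num⟩
  rw [Set.mem_ofPred_eq] at hx hx'
  exact lt_asymm hx hx'

end Pentagon

end StraightSkeleton

end

theorem mainTheorem6 :
    (∀ (n : ℕ) (P : StraightSkeleton.SimplePolygon n) (δ : Fin n → ℝ≥0)
      (W : StraightSkeleton.Propagation P δ) (e : Fin n), IsConnected (W.face e)) ∧
    (∃ (n : ℕ) (P : StraightSkeleton.SimplePolygon n) (δ : Fin n → ℝ≥0)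
      (W : StraightSkeleton.Propagation P δ) (e : Fin n), interior (W.face e) = ∅) ∧
    (∃ (n : ℕ) (P : StraightSkeleton.SimplePolygon n) (δ : Fin n → ℝ≥0)
      (W : StraightSkeleton.Propagation P δ) (e : Fin n),
      (interior (W.face e)).Nonempty ∧ ¬ IsPreconnected (interior (W.face e))) ∧
    (∃ (n : ℕ) (P : StraightSkeleton.SimplePolygon n) (δ : Fin n → ℝ≥0)
      (W : StraightSkeleton.Propagation P δ) (e : Fin n),
      (interior (W.face e)).Nonempty ∧
        Disjoint (closure (interior (W.face e))) (P.edgeSet ℝ e)) :=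
  ⟨fun _ _ _ W e => W.isConnected_face e,
    ⟨4, _, _, StraightSkeleton.Dart.propagation, 2, StraightSkeleton.Dart.interior_face_two⟩,
    ⟨5, _, _, StraightSkeleton.Pentagon.propagation, 0,
      StraightSkeleton.Pentagon.nonempty_interior_face_zero,
      StraightSkeleton.Pentagon.not_isPreconnected_interior_face_zero⟩,
    ⟨4, _, _, StraightSkeleton.Dart.propagation, 0,
      StraightSkeleton.Dart.nonempty_interior_face_zero,
      StraightSkeleton.Dart.disjoint_closure_interior_face_zero⟩⟩
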